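/- Let $(S,\Sigma,P)$ be a probability space such that $P$ is adequate, that is, either nonatomic (every event $A$ with $P(A)>0$ contains an event $B\subseteq A$ with $0<P(B)<P(A)$) or uniform on a finite partition of $S$ that generates $\Sigma$. Let $\mathcal F$ be either the space $\mathcal L^\infty$ of all almost surely bounded random variables $f:S\to\mathbb R$, or the space $\mathcal M^\infty=\bigcap_{p\in\mathbb N}\mathcal L^p$ of all random variables with finite absolute moments of all orders; identify each $\gamma\in\mathbb R$ with the constant random variable $\gamma\in\mathcal F$, and write $f\overset{d}{=}g$ when $f$ and $g$ have the same distribution under $P$. For a binary relation $\succsim$ on $\mathcal F$ write $f\sim g$ when $f\succsim g$ and $g\succsim f$, and $f\succ g$ when $f\succsim g$ and not $g\succsim f$. The relation $\succsim$ is a risk preference when it is transitive and law invariant, i.e. $f\overset{d}{=}g$ implies $f\sim g$. It is monotone when $w+\varepsilon\succ w$ for all $w\in\mathcal F$ and all real $\varepsilon>0$, and secular when for all $f,g\in\mathcal F$ there exists $\rho\in\mathbb R$ such that $g\sim f-\rho$. If $\succsim$ is a monotone and secular risk preference, then this $\rho$ is unique for all $f,g\in\mathcal F$ and is denoted by $\rho(g,f)$.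 Let $\succsim_{\mathrm A}$ and $\succsim_{\mathrm B}$ be two monotone and secular risk preferences on $\mathcal F$, with associated functions $\rho_{\mathrm A}$ and $\rho_{\mathrm B}$. Then the following properties are equivalent: (i) $\mathrm B$ is weakly more risk averse than $\mathrm A$: for all $f\in\mathcal F$ and $\gamma\in\mathbb R$, if $\gamma\succsim_{\mathrm A}f$ then $\gamma\succsim_{\mathrm B}f$; (ii) $\mathrm B$ is more propense to full insurance than $\mathrm A$: for all $w,f,g\in\mathcal F$ with $g\overset{d}{=}f$, if $f=-w-\pi$ for some $\pi\in\mathbb R$ (i.e. $f$ is a full insurance for $w$), then $$\rho_{\mathrm B}(w+g,w+f)\ \ge\ \rho_{\mathrm A}(w+g,w+f).$$ -/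

import Mathlib

open MeasureTheory

namespace InsurancePropensity

/-- A measure is nonatomic when every event of positive measure contains an event of strictly
smaller positive measure. -/
def IsNonatomic {S : Type*} [MeasurableSpace S] (P : Measure S) : Prop :=
  ∀ A : Set S, MeasurableSet A → 0 < P A →
    ∃ B : Set S, B ⊆ A ∧ MeasurableSet B ∧ 0 < P B ∧ P B < P A

/-- `P` is uniform on a finite partition that generates the sigma-algebra: the `n` cells are
disjoint, cover `S`, generate the sigma-algebra, and all have probability `1 / n`. -/
def IsUniformOnFinitePartition {S : Type*} [m : MeasurableSpace S] (P : Measure S) : Prop :=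
  ∃ (n : ℕ) (E : Fin n → Set S),
    Pairwise (fun i j => Disjoint (E i) (E j)) ∧
    (⋃ i, E i) = Set.univ ∧
    m = MeasurableSpace.generateFrom (Set.range E) ∧
    ∀ i, P (E i) = (n : ENNReal)⁻¹

/-- A measure is adequate when it is either nonatomic or uniform on a finite partition that
generates the sigma-algebra. -/
def IsAdequate {S : Type*} [MeasurableSpace S] (P : Measure S) : Prop :=
  IsNonatomic P ∨ IsUniformOnFinitePartition P

/-- The two possible spaces of random payoffs: the almost surely bounded random variables, and
the random variables with finite moments of all orders. -/
inductive PayoffClass where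
  | bounded : PayoffClass
  | allMoments : PayoffClass

/-- The space of random payoffs, a linear space of measurable functions (not of almost sure
equivalence classes). -/
def payoffs {S : Type*} [MeasurableSpace S] (P : Measure S) :
    PayoffClass → Submodule ℝ (S → ℝ)
  | .bounded =>
    { carrier := {f | Measurable f ∧ MemLp f ⊤ P}
      add_mem' := fun hf hg => ⟨hf.1.add hg.1, hf.2.add hg.2⟩
      zero_mem' := ⟨measurable_const, MemLp.zero'⟩
      smul_mem' := fun c _ hf => ⟨hf.1.const_smul c, hf.2.const_smul c⟩ }
  | .allMoments =>
    { carrier := {f | Measurable f ∧ ∀ p : ℕ, MemLp f p P}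
      add_mem' := fun hf hg => ⟨hf.1.add hg.1, fun p => (hf.2 p).add (hg.2 p)⟩
      zero_mem' := ⟨measurable_const, fun _ => MemLp.zero'⟩
      smul_mem' := fun c _ hf => ⟨hf.1.const_smul c, fun p => (hf.2 p).const_smul c⟩ }

section

variable {S : Type*} [MeasurableSpace S] {P : Measure S} [IsProbabilityMeasure P]
  {c : PayoffClass}

theorem const_mem_payoffs (P : Measure S) [IsProbabilityMeasure P] (c : PayoffClass) (γ : ℝ) :
    (fun _ : S => γ) ∈ payoffs P c := by
  cases c with
  | bounded => exact ⟨measurable_const, memLp_const γ⟩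
  | allMoments => exact ⟨measurable_const, fun _ => memLp_const γ⟩

/-- The sure payoff `γ`. -/
def sure (P : Measure S) [IsProbabilityMeasure P] (c : PayoffClass) (γ : ℝ) : payoffs P c :=
  ⟨fun _ => γ, const_mem_payoffs P c γ⟩

/-- Two random payoffs are equally distributed when they induce the same law on the reals. -/
def EqDistrib (f g : payoffs P c) : Prop :=
  P.map (f : S → ℝ) = P.map (g : S → ℝ)

/-- Indifference. -/
def Indiff (R : payoffs P c → payoffs P c → Prop) (f g : payoffs P c) : Prop :=
  R f g ∧ R g f

/-- Strict preference. -/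
def Strict (R : payoffs P c → payoffs P c → Prop) (f g : payoffs P c) : Prop :=
  R f g ∧ ¬ R g f

/-- A risk preference is a transitive and law invariant binary relation on random payoffs;
`R f g` means that `f` is (weakly) preferred to `g`. -/
structure IsRiskPreference (R : payoffs P c → payoffs P c → Prop) : Prop where
  trans : ∀ f g h : payoffs P c, R f g → R g h → R f h
  law_invariant : ∀ f g : payoffs P c, EqDistrib f g → Indiff R f g

/-- Adding a sure positive payoff yields a strictly preferred random payoff. -/
def IsMonotone (R : payoffs P c → payoffs P c → Prop) : Prop :=
  ∀ (w : payoffs P c) (ε : ℝ), 0 < ε → Strict R (w + sure P c ε) w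

/-- Every random payoff is traded for any other one at some sure price. -/
def IsSecular (R : payoffs P c → payoffs P c → Prop) : Prop :=
  ∀ f g : payoffs P c, ∃ ρ : ℝ, Indiff R g (f - sure P c ρ)

/-- A monotone and secular risk preference. -/
structure IsMonotoneSecular (R : payoffs P c → payoffs P c → Prop) : Prop
    extends IsRiskPreference R where
  monotone : IsMonotone R
  secular : IsSecular R

theorem IsMonotoneSecular.existsUnique {R : payoffs P c → payoffs P c → Prop}
    (h : IsMonotoneSecular R) (g f : payoffs P c) :
    ∃! ρ : ℝ, Indiff R g (f - sure P c ρ) := by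
  have key : ∀ a b : ℝ, Indiff R g (f - sure P c a) → Indiff R g (f - sure P c b) →
      ¬ a < b := by
    intro a b ha hb hab
    have hm := h.monotone (f - sure P c b) (b - a) (sub_pos.2 hab)
    have e : f - sure P c b + sure P c (b - a) = f - sure P c a := by
      ext s
      simp [sure]
    rw [e] at hm
    exact hm.2 (h.trans _ _ _ hb.2 ha.1)
  obtain ⟨ρ, hρ⟩ := h.secular f g
  exact ⟨ρ, hρ, fun y hy => le_antisymm (not_lt.1 (key ρ y hρ hy)) (not_lt.1 (key y ρ hy hρ))⟩

/-- `h.rho g f` is the willingness to pay for trading `g` with `f`: the unique real `ρ` such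
that the agent is indifferent between `g` and `f - ρ`. -/
noncomputable def IsMonotoneSecular.rho {R : payoffs P c → payoffs P c → Prop}
    (h : IsMonotoneSecular R) (g f : payoffs P c) : ℝ :=
  (h.existsUnique g f).choose

theorem IsMonotoneSecular.rho_spec {R : payoffs P c → payoffs P c → Prop}
    (h : IsMonotoneSecular R) (g f : payoffs P c) :
    Indiff R g (f - sure P c (h.rho g f)) :=
  (h.existsUnique g f).choose_spec.1

/-- `f` is a full insurance for `w`: `f = -w - π` for some premium `π`. -/
def IsFullInsurance (w f : payoffs P c) : Prop :=
  ∃ π : ℝ, f = -w - sure P c π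

/-- `RB` is weakly more risk averse than `RA`: whenever `A` prefers a sure payoff to a random
one, so does `B`. -/
def WeaklyMoreRiskAverse (RB RA : payoffs P c → payoffs P c → Prop) : Prop :=
  ∀ (f : payoffs P c) (γ : ℝ), RA (sure P c γ) f → RB (sure P c γ) f

/-- `RB` is more propense to full insurance than `RA`. -/
def MorePropenseToFullInsurance {RB RA : payoffs P c → payoffs P c → Prop}
    (hB : IsMonotoneSecular RB) (hA : IsMonotoneSecular RA) : Prop :=
  ∀ w f g : payoffs P c, EqDistrib g f → IsFullInsurance w f →
    hA.rho (w + g) (w + f) ≤ hB.rho (w + g) (w + f)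

end

end InsurancePropensity

/-! The willingness to pay for a sure payoff encodes a certainty equivalent: `g ∼ a - ρ(g, a)`, and
monotonicity orders sure payoffs as real numbers, so `γ ≿ g` means `a - ρ(g, a) ≤ γ` for any real
`a` (`IsMonotoneSecular.sure_iff_rho`). Full insurance turns `w + f` into a sure payoff, so
propensity to full insurance compares the certainty equivalents of the payoffs `w + g`. Hence (i)
gives (ii) at once.

The converse needs every payoff to arise, in law, as such a `w + g`, that is, as a constant plus a
difference `w' - w` of identically distributed payoffs (`IsAdequate.exists_eqDistrib_sub`). On a
finite uniform space, subtract the mean and take partial sums around a cycle. On a nonatomic space,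
the continuous analogue is a mixture of interval rotations: a point uniform on `[0, x - y)`, with `y
≤ 0 < x`, is rotated by `x`. Its law is unchanged, while its displacement is `x` or `y` with weights
`-y` and `x`. Averaging over independent `x`, `y` drawn from a centered law reproduces that law
(`exists_coupling_of_integral_eq_zero`). Nonatomicity realizes the resulting joint law on `S`. -/

namespace InsurancePropensity
-- Sierpiński's theorem for nonatomic measures
section Nonatomic
open Filter Topology

variable {S : Type*} [MeasurableSpace S] {P : Measure S} [IsFiniteMeasure P]

theorem IsNonatomic.exists_real_le_half (hP : IsNonatomic P) {A : Set S} (hA : MeasurableSet A)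
    (h0 : 0 < P.real A) :
    ∃ B ⊆ A, MeasurableSet B ∧ 0 < P.real B ∧ P.real B ≤ P.real A / 2 := by
  obtain ⟨B, hBA, hB, hB0, hBlt⟩ := hP A hA (by simpa [measureReal_def, ENNReal.toReal_pos_iff] using h0)
  have h1 : 0 < P.real B := ENNReal.toReal_pos hB0.ne' (measure_ne_top _ _)
  have h2 : P.real B < P.real A :=
    (ENNReal.toReal_lt_toReal (measure_ne_top _ _) (measure_ne_top _ _)).2 hBlt
  have h3 : P.real (A \ B) = P.real A - P.real B := measureReal_sdiff hBA hB
  rcases le_total (P.real B) (P.real A / 2) with h | h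
  · exact ⟨B, hBA, hB, h1, h⟩
  · exact ⟨A \ B, Set.sdiff_subset, hA.diff hB, by linarith, by linarith⟩

theorem IsNonatomic.exists_real_le (hP : IsNonatomic P) {A : Set S} (hA : MeasurableSet A)
    (h0 : 0 < P.real A) {ε : ℝ} (hε : 0 < ε) :
    ∃ B ⊆ A, MeasurableSet B ∧ 0 < P.real B ∧ P.real B ≤ ε := by
  have key : ∀ n : ℕ, ∃ B ⊆ A, MeasurableSet B ∧ 0 < P.real B ∧
      P.real B ≤ P.real A * (1 / 2) ^ n := by
    intro n
    induction n with
    | zero => exact ⟨A, subset_rfl, hA, h0, by simp⟩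
    | succ n ih =>
      obtain ⟨B, hBA, hB, hB0, hBle⟩ := ih
      obtain ⟨C, hCB, hC, hC0, hCle⟩ := hP.exists_real_le_half hB hB0
      exact ⟨C, hCB.trans hBA, hC, hC0, by rw [pow_succ]; linarith⟩
  obtain ⟨n, hn⟩ := exists_pow_lt_of_lt_one (div_pos hε h0) (by norm_num : (1 / 2 : ℝ) < 1)
  obtain ⟨B, hBA, hB, hB0, hBle⟩ := key n
  refine ⟨B, hBA, hB, hB0, hBle.trans ?_⟩
  rw [lt_div_iff₀ h0] at hn
  linarith

omit [IsFiniteMeasure P] in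
-- The supremum of admissible measures need not be known to be attained; the factor `2` leaves room
-- for an actual set. This drives the greedy exhaustion in `IsNonatomic.exists_real_eq`.
theorem exists_nearly_largest_subset {A : Set S} {t : ℝ} (ht : 0 ≤ t) :
    ∃ C ⊆ A, MeasurableSet C ∧ P.real C ≤ t ∧
      ∀ D ⊆ A, MeasurableSet D → P.real D ≤ t → P.real D ≤ 2 * P.real C := by
  set V : Set ℝ := {r | ∃ D ⊆ A, MeasurableSet D ∧ P.real D ≤ t ∧ P.real D = r} with hV
  have hbdd : BddAbove V := ⟨t, by rintro _ ⟨D, -, -, h, rfl⟩; exact h⟩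
  have h0V : (0 : ℝ) ∈ V := ⟨∅, by simp, by simp, by simpa, by simp⟩
  have hle : ∀ D ⊆ A, MeasurableSet D → P.real D ≤ t → P.real D ≤ sSup V :=
    fun D h1 h2 h3 => le_csSup hbdd ⟨D, h1, h2, h3, rfl⟩
  rcases (le_csSup hbdd h0V).eq_or_lt with h | h
  · exact ⟨∅, by simp, by simp, by simpa, fun D h1 h2 h3 => by simpa [← h] using hle D h1 h2 h3⟩
  · obtain ⟨_, ⟨C, h1, h2, h3, rfl⟩, hC⟩ := exists_lt_of_lt_csSup ⟨0, h0V⟩ (half_lt_self h)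
    exact ⟨C, h1, h2, h3, fun D h1 h2 h3 => by linarith [hle D h1 h2 h3]⟩

/-- Sierpiński's theorem: a nonatomic finite measure takes all intermediate values. -/
theorem IsNonatomic.exists_real_eq (hP : IsNonatomic P) {A : Set S} (hA : MeasurableSet A)
    {t : ℝ} (ht : 0 ≤ t) (htA : t ≤ P.real A) :
    ∃ B ⊆ A, MeasurableSet B ∧ P.real B = t := by
  -- Greedy exhaustion: each step adds to `B` a subset of `A \ B` at least half as large as any that
  -- still fits under `t`.
  let T := {B : Set S // B ⊆ A ∧ MeasurableSet B ∧ P.real B ≤ t}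
  have step : ∀ B : T, ∃ B' : T, B.1 ⊆ B'.1 ∧ ∀ D ⊆ A \ B.1, MeasurableSet D →
      P.real D ≤ t - P.real B.1 → P.real D ≤ 2 * (P.real B'.1 - P.real B.1) := by
    rintro ⟨B, hBA, hB, hBt⟩
    obtain ⟨C, hCA, hC, hCt, hmax⟩ :=
      exists_nearly_largest_subset (P := P) (A := A \ B) (sub_nonneg.2 hBt)
    have hU : P.real (B ∪ C) = P.real B + P.real C :=
      measureReal_union (Set.disjoint_sdiff_right.mono_right hCA) hC
    refine ⟨⟨B ∪ C, Set.union_subset hBA (hCA.trans Set.sdiff_subset), hB.union hC, by linarith⟩,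
      Set.subset_union_left, fun D h1 h2 h3 => ?_⟩
    have := hmax D h1 h2 h3
    simp only [hU]
    linarith
  choose next hsub hnext using step
  let B : ℕ → T := fun n => next^[n] ⟨∅, by simp, by simp, by simpa⟩
  have hBs : ∀ n, B (n + 1) = next (B n) := fun n => Function.iterate_succ_apply' _ _ _
  have hmono : Monotone fun n => (B n).1 :=
    monotone_nat_of_le_succ fun n => by rw [hBs]; exact hsub _
  have hlim : Tendsto (fun n => P.real (B n).1) atTop (𝓝 (P.real (⋃ n, (B n).1))) :=
    (ENNReal.tendsto_toReal (measure_ne_top _ _)).comp (tendsto_measure_iUnion_atTop hmono)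
  have hmeas : MeasurableSet (⋃ n, (B n).1) := MeasurableSet.iUnion fun n => (B n).2.2.1
  have hle : P.real (⋃ n, (B n).1) ≤ t := le_of_tendsto' hlim fun n => (B n).2.2.2
  have hsubA : (⋃ n, (B n).1) ⊆ A := Set.iUnion_subset fun n => (B n).2.1
  refine ⟨_, hsubA, hmeas, hle.antisymm (not_lt.1 fun hlt => ?_)⟩
  have hpos : 0 < P.real (A \ ⋃ n, (B n).1) := by
    rw [measureReal_sdiff hsubA hmeas]; linarith
  -- If the union fell short of `t`, this `D` would fit at every step, so each increment would be at
  -- least half its measure; yet the increments tend to zero.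
  obtain ⟨D, hDA, hD, hD0, hDt⟩ := hP.exists_real_le (hA.diff hmeas) hpos (sub_pos.2 hlt)
  have hgap : Tendsto (fun n => 2 * (P.real (B (n + 1)).1 - P.real (B n).1)) atTop (𝓝 0) := by
    simpa using ((hlim.comp (tendsto_add_atTop_nat 1)).sub hlim).const_mul 2
  refine hD0.not_ge (ge_of_tendsto' hgap fun n => ?_)
  rw [hBs]
  refine hnext _ D (hDA.trans (Set.sdiff_subset_sdiff_right (Set.subset_iUnion (fun n => (B n).1) n))) hD ?_
  have : P.real (B n).1 ≤ P.real (⋃ n, (B n).1) := measureReal_mono (Set.subset_iUnion (fun n => (B n).1) n)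
  linarith

/-- Appends one binary digit to `u` by splitting each level set into two halves. Only odd thresholds
need a formula, since `v < 2 * k` is the same as `u < k`. -/
theorem IsNonatomic.exists_bisection (hP : IsNonatomic P) {u : S → ℕ} (hu : Measurable u) :
    ∃ v : S → ℕ, Measurable v ∧ (∀ s, 2 * u s ≤ v s ∧ v s ≤ 2 * u s + 1) ∧
      ∀ k, P.real {s | v s < 2 * k + 1} = (P.real {s | u s < k} + P.real {s | u s < k + 1}) / 2 := by
  have half : ∀ k : ℕ, ∃ B ⊆ {s | u s = k}, MeasurableSet B ∧
      P.real B = P.real {s | u s = k} / 2 := fun k =>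
    hP.exists_real_eq (hu (measurableSet_singleton k)) (by positivity)
      (half_le_self measureReal_nonneg)
  choose B hBu hB hBhalf using half
  have hBU : MeasurableSet (⋃ k, B k) := MeasurableSet.iUnion hB
  classical
  refine ⟨fun s => 2 * u s + if s ∈ ⋃ k, B k then 0 else 1,
    (hu.const_mul 2).add (Measurable.ite hBU measurable_const measurable_const),
    fun s => by dsimp only; split_ifs <;> omega, fun k => ?_⟩
  have hlt : MeasurableSet {s | u s < k} := hu (measurableSet_Iio (a := k))
  have e1 : {s | (2 * u s + if s ∈ ⋃ k, B k then 0 else 1) < 2 * k + 1} =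
      {s | u s < k} ∪ B k := by
    ext s
    by_cases hs : s ∈ ⋃ k, B k
    · obtain ⟨j, hj⟩ := Set.mem_iUnion.1 hs
      have hj' : u s = j := hBu j hj
      have hk : s ∈ B k ↔ j = k := ⟨fun h => hj'.symm.trans (hBu k h), fun h => h ▸ hj⟩
      simp only [Set.mem_ofPred_eq, hs, if_true, Set.mem_union, hk]
      omega
    · have hk : s ∉ B k := fun h => hs (Set.mem_iUnion.2 ⟨k, h⟩)
      simp only [Set.mem_ofPred_eq, hs, if_false, Set.mem_union, hk, or_false]
      omega
  have e2 : {s | u s < k + 1} = {s | u s < k} ∪ {s | u s = k} := by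
    ext s; simp only [Set.mem_ofPred_eq, Set.mem_union]; omega
  have hd : Disjoint {s | u s < k} {s | u s = k} :=
    Set.disjoint_left.2 fun s h1 h2 => (Nat.ne_of_lt h1) h2
  rw [e1, e2, measureReal_union (hd.mono_right (hBu k)) (hB k),
    measureReal_union hd (hu (measurableSet_singleton k)), hBhalf]
  ring

end Nonatomic

/-! ### Uniform variables and prescribed laws on a nonatomic space -/

section Uniform
open Filter Topology unitInterval

variable {S : Type*} [MeasurableSpace S] {P : Measure S} [IsProbabilityMeasure P]

/-- Iterated bisection from the constant `0`: `u n` plays the role of the integer formed by the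
first `n` binary digits of a uniform variable. -/
theorem IsNonatomic.exists_dyadic_approximations (hP : IsNonatomic P) :
    ∃ u : ℕ → S → ℕ, (∀ n, Measurable (u n)) ∧
      (∀ n s, 2 * u n s ≤ u (n + 1) s ∧ u (n + 1) s ≤ 2 * u n s + 1) ∧
      (∀ n s, u n s < 2 ^ n) ∧
      ∀ n, ∀ k ≤ 2 ^ n, P.real {s | u n s < k} = k / 2 ^ n := by
  choose next hmeas hnext hreal using
    fun u : {u : S → ℕ // Measurable u} => hP.exists_bisection u.2
  let w : ℕ → {u : S → ℕ // Measurable u} := fun n =>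
    (fun u => ⟨next u, hmeas u⟩)^[n] ⟨fun _ => 0, measurable_const⟩
  have hws : ∀ n, (w (n + 1)).1 = next (w n) := fun n =>
    congrArg Subtype.val (Function.iterate_succ_apply' _ _ _)
  have hstep : ∀ n s, 2 * (w n).1 s ≤ (w (n + 1)).1 s ∧ (w (n + 1)).1 s ≤ 2 * (w n).1 s + 1 := by
    intro n s; rw [hws]; exact hnext _ s
  refine ⟨fun n => (w n).1, fun n => (w n).2, hstep, fun n => ?_, fun n => ?_⟩
  · induction n with
    | zero => intro s; exact Nat.zero_lt_one
    | succ n ih => intro s; have := ih s; have := hstep n s; rw [pow_succ]; dsimp only at *; omega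
  · induction n with
    | zero =>
      intro k hk
      obtain rfl | rfl : k = 0 ∨ k = 1 := by simp at hk; omega
      · simp
      · have : {s | (w 0).1 s < 1} = Set.univ := Set.eq_univ_of_forall fun s => Nat.zero_lt_one
        dsimp only
        rw [this]
        simp
    | succ n ih =>
      intro k hk
      dsimp only at ih ⊢
      rw [pow_succ] at hk
      obtain ⟨j, rfl | rfl⟩ := Nat.even_or_odd' k
      · have : {s | (w (n + 1)).1 s < 2 * j} = {s | (w n).1 s < j} := by
          ext s; have := hstep n s; simp only [Set.mem_ofPred_eq]; omega
        rw [this, ih j (by omega)]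
        push_cast
        rw [pow_succ]
        field_simp
      · rw [hws, hreal, ih j (by omega), ih (j + 1) (by omega)]
        push_cast
        field_simp
        ring

/-- A nonatomic probability space carries a uniformly distributed random variable. -/
theorem IsNonatomic.exists_uniform (hP : IsNonatomic P) :
    ∃ U : S → I, Measurable U ∧ P.map U = volume := by
  obtain ⟨u, hu, hstep, hlt, hreal⟩ := hP.exists_dyadic_approximations
  set a : ℕ → S → ℝ := fun n s => u n s / 2 ^ n with ha
  have hmono : ∀ s, Monotone fun n => a n s := fun s => monotone_nat_of_le_succ fun n => by
    have : (2 * u n s : ℝ) ≤ u (n + 1) s := by exact_mod_cast (hstep n s).1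
    simp only [ha, pow_succ]
    rw [div_le_div_iff₀ (by positivity) (by positivity)]
    nlinarith [pow_pos (two_pos (α := ℝ)) n]
  have hanti : ∀ s, Antitone fun n => a n s + 1 / 2 ^ n := fun s => antitone_nat_of_succ_le fun n => by
    have : (u (n + 1) s : ℝ) ≤ 2 * u n s + 1 := by exact_mod_cast (hstep n s).2
    simp only [ha, pow_succ, ← add_div]
    rw [div_le_div_iff₀ (by positivity) (by positivity)]
    nlinarith [pow_pos (two_pos (α := ℝ)) n]
  have hcross : ∀ s n m, a m s ≤ a n s + 1 / 2 ^ n := fun s n m =>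
    calc a m s ≤ a (max m n) s := hmono s (le_max_left _ _)
      _ ≤ a (max m n) s + 1 / 2 ^ max m n := le_add_of_nonneg_right (by positivity)
      _ ≤ _ := hanti s (le_max_right _ _)
  have hbdd : ∀ s, BddAbove (Set.range fun n => a n s) := fun s =>
    ⟨_, by rintro _ ⟨m, rfl⟩; exact hcross s 0 m⟩
  set V : S → ℝ := fun s => ⨆ n, a n s with hV
  have hVm : Measurable V := Measurable.iSup fun n =>
    ((measurable_from_top (f := (Nat.cast : ℕ → ℝ))).comp (hu n)).div_const _
  have hle : ∀ n s, a n s ≤ V s := fun n s => le_ciSup (hbdd s) n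
  have hge : ∀ n s, V s ≤ a n s + 1 / 2 ^ n := fun n s => ciSup_le fun m => hcross s n m
  have hVI : ∀ s, V s ∈ I := fun s => by
    have h0 : u 0 s = 0 := by simpa using hlt 0 s
    have h1 := hle 0 s
    have h2 := hge 0 s
    simp only [ha, h0] at h1 h2
    exact ⟨by simpa using h1, by simpa using h2⟩
  refine ⟨fun s => ⟨V s, hVI s⟩, hVm.subtype_mk, ?_⟩
  have hUm : Measurable fun s => (⟨V s, hVI s⟩ : I) := hVm.subtype_mk
  have : IsProbabilityMeasure (P.map fun s => (⟨V s, hVI s⟩ : I)) :=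
    Measure.isProbabilityMeasure_map hUm.aemeasurable
  refine Measure.ext_of_Iic _ _ fun x => ?_
  rw [Measure.map_apply hUm measurableSet_Iic, unitInterval.volume_Iic]
  have key : P.real {s | V s ≤ x} = x := by
    -- With `k = ⌊x * 2 ^ n⌋`, the event `V ≤ x` contains `u n < k` and is contained in `u n < k +
    -- 1`. The case `k = 2 ^ n` falls outside the range of `hreal`, and there the upper bound is
    -- trivial.
    have bounds : ∀ n : ℕ, |P.real {s | V s ≤ x} - x| ≤ (1 / 2) ^ n := by
      intro n
      have h2 : (0 : ℝ) < 2 ^ n := by positivity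
      have hx0 : 0 ≤ (x : ℝ) * 2 ^ n := mul_nonneg x.2.1 h2.le
      have hk1 := Nat.floor_le hx0
      have hk2 := Nat.lt_floor_add_one ((x : ℝ) * 2 ^ n)
      set k := ⌊(x : ℝ) * 2 ^ n⌋₊
      have hkle : k ≤ 2 ^ n := by
        have : (k : ℝ) ≤ ((2 ^ n : ℕ) : ℝ) := by
          push_cast; nlinarith [x.2.2]
        exact_mod_cast this
      have lower : (k : ℝ) / 2 ^ n ≤ P.real {s | V s ≤ x} := by
        rw [← hreal n k hkle]
        refine measureReal_mono fun s hs => (hge n s).trans ?_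
        have hs' : (u n s : ℝ) + 1 ≤ k := by exact_mod_cast (show u n s < k from hs)
        simp only [ha, ← add_div]
        rw [div_le_iff₀ h2]
        linarith
      have upper : P.real {s | V s ≤ x} ≤ (k + 1) / 2 ^ n := by
        rcases hkle.lt_or_eq with h | h
        · have := hreal n (k + 1) h
          push_cast at this
          rw [← this]
          refine measureReal_mono fun s hs => ?_
          have hs' : a n s ≤ x := (hle n s).trans hs
          simp only [ha] at hs'
          rw [div_le_iff₀ h2] at hs'
          have : (u n s : ℝ) < (k + 1 : ℕ) := by push_cast; linarith
          exact_mod_cast this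
        · refine measureReal_le_one.trans ?_
          rw [le_div_iff₀ h2, h]
          push_cast
          linarith
      rw [div_le_iff₀ h2] at lower
      rw [le_div_iff₀ h2] at upper
      rw [one_div, inv_pow, abs_le]
      have hi : ((2 : ℝ) ^ n)⁻¹ * 2 ^ n = 1 := inv_mul_cancel₀ h2.ne'
      constructor <;> refine le_of_mul_le_mul_right ?_ h2 <;> nlinarith
    have h0 : |P.real {s | V s ≤ x} - x| ≤ 0 :=
      ge_of_tendsto' (tendsto_pow_atTop_nhds_zero_of_lt_one (by norm_num) (by norm_num)) bounds
    exact sub_eq_zero.1 (abs_nonpos_iff.1 h0)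
  rw [← ofReal_measureReal (measure_ne_top _ _)]
  exact congrArg ENNReal.ofReal key

/-- A nonatomic probability space carries random elements of every standard Borel law. -/
theorem IsNonatomic.exists_map_eq (hP : IsNonatomic P) {Y : Type*} [MeasurableSpace Y]
    [StandardBorelSpace Y] (ν : Measure Y) [IsProbabilityMeasure ν] :
    ∃ X : S → Y, Measurable X ∧ P.map X = ν := by
  have : Nonempty Y := nonempty_of_isProbabilityMeasure ν
  obtain ⟨U, hU, hUmap⟩ := hP.exists_uniform
  obtain ⟨f, hf, hfmap⟩ := ν.exists_measurable_map_eq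
  exact ⟨f ∘ U, hf.comp hU, by rw [← Measure.map_map hf hU, hUmap, hfmap]⟩

end Uniform

/-! ### Coupling by random rotations of intervals -/

section Coupling

/-- The region of `((x, y), w)` with `y ≤ 0 < x` and `0 ≤ w < x - y`. -/
def coupleRegion : Set ((ℝ × ℝ) × ℝ) :=
  {q | 0 < q.1.1 ∧ q.1.2 ≤ 0 ∧ 0 ≤ q.2 ∧ q.2 < q.1.1 - q.1.2}

/-- Rotation of the interval `[0, x - y)` by `x`. -/
noncomputable def coupleShift (q : (ℝ × ℝ) × ℝ) : ℝ :=
  if q.2 < -q.1.2 then q.2 + q.1.1 else q.2 + q.1.2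

/-- The law under which `w` is, given `(x, y)`, uniform on `[0, x - y)`, up to normalization. -/
noncomputable def coupleMeasure (μ : Measure ℝ) : Measure ((ℝ × ℝ) × ℝ) :=
  ((μ.prod μ).prod volume).restrict coupleRegion

theorem measurableSet_coupleRegion : MeasurableSet coupleRegion := by
  unfold coupleRegion
  measurability

theorem measurable_coupleShift : Measurable coupleShift := by
  refine Measurable.ite (measurableSet_lt ?_ ?_) ?_ ?_ <;> fun_prop

theorem coupleMeasure_apply (μ : Measure ℝ) [IsProbabilityMeasure μ] {A : Set ((ℝ × ℝ) × ℝ)}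
    (hA : MeasurableSet A) :
    coupleMeasure μ A = ∫⁻ p, volume {w : ℝ | (p, w) ∈ A ∩ coupleRegion} ∂(μ.prod μ) := by
  rw [coupleMeasure, Measure.restrict_apply hA,
    Measure.prod_apply (hA.inter measurableSet_coupleRegion)]
  rfl

/-- The rotation exchanges the pieces `[0, -y)` and `[-y, x - y)` by translations, and Lebesgue
measure is translation invariant. -/
theorem volume_rotation_preimage {x y : ℝ} (hx : 0 < x) (hy : y ≤ 0) {A : Set ℝ}
    (hA : MeasurableSet A) :
    volume {w | coupleShift ((x, y), w) ∈ A ∧ 0 ≤ w ∧ w < x - y} =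
      volume {w | w ∈ A ∧ 0 ≤ w ∧ w < x - y} := by
  have split : ∀ (B : Set ℝ) (a b c : ℝ), MeasurableSet B → a ≤ b → b ≤ c →
      volume {w | w ∈ B ∧ a ≤ w ∧ w < c} =
        volume {w | w ∈ B ∧ a ≤ w ∧ w < b} + volume {w | w ∈ B ∧ b ≤ w ∧ w < c} := by
    intro B a b c hB hab hbc
    rw [← measure_union]
    · congr 1; ext w; simp only [Set.mem_union, Set.mem_ofPred_eq]; grind
    · rw [Set.disjoint_left]; rintro w ⟨-, -, h1⟩ ⟨-, h2, -⟩; linarith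
    · exact hB.inter (measurableSet_Ico (a := b) (b := c))
  have hS : MeasurableSet {w | coupleShift ((x, y), w) ∈ A} :=
    (measurable_coupleShift.comp measurable_prodMk_left) hA
  have e1 : {w | coupleShift ((x, y), w) ∈ A ∧ 0 ≤ w ∧ w < -y} =
      (fun w => w + x) ⁻¹' {w | w ∈ A ∧ x ≤ w ∧ w < x - y} := by
    ext w; simp only [Set.mem_ofPred_eq, Set.mem_preimage, coupleShift]; grind
  have e2 : {w | coupleShift ((x, y), w) ∈ A ∧ -y ≤ w ∧ w < x - y} =
      (fun w => w + y) ⁻¹' {w | w ∈ A ∧ 0 ≤ w ∧ w < x} := by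
    ext w; simp only [Set.mem_ofPred_eq, Set.mem_preimage, coupleShift]; grind
  have h := split _ 0 (-y) (x - y) hS (by linarith) (by linarith)
  simp only [Set.mem_ofPred_eq] at h
  rw [h, e1, e2, measure_preimage_add_right, measure_preimage_add_right,
    split A 0 x (x - y) hA hx.le (by linarith), add_comm]

theorem coupleMeasure_map_shift (μ : Measure ℝ) [IsProbabilityMeasure μ] :
    (coupleMeasure μ).map coupleShift = (coupleMeasure μ).map Prod.snd := by
  ext A hA
  rw [Measure.map_apply measurable_coupleShift hA, Measure.map_apply measurable_snd hA,
    coupleMeasure_apply μ (measurable_coupleShift hA), coupleMeasure_apply μ (measurable_snd hA)]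
  refine lintegral_congr fun p => ?_
  obtain ⟨x, y⟩ := p
  by_cases h : 0 < x ∧ y ≤ 0
  · simpa [coupleRegion, h] using volume_rotation_preimage h.1 h.2 hA
  · have : ∀ w, ((x, y), w) ∉ coupleRegion := fun w hw => h ⟨hw.1, hw.2.1⟩
    simp [this]

/-- The displacement is `x` on a piece of length `-y` and `y` on a piece of length `x`. Outside `y ≤
0 < x` both products vanish, so the formula holds for all pairs and separates the variables. -/
theorem volume_rotation_displacement (x y : ℝ) (A : Set ℝ) :
    volume {w | ((x, y), w) ∈ (fun q => coupleShift q - q.2) ⁻¹' A ∩ coupleRegion} =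
      (A ∩ Set.Ioi 0).indicator 1 x * ENNReal.ofReal (-y) +
        ENNReal.ofReal x * (A ∩ Set.Iic 0).indicator 1 y := by
  classical
  by_cases h : 0 < x ∧ y ≤ 0
  · obtain ⟨hx, hy⟩ := h
    have e : {w | ((x, y), w) ∈ (fun q => coupleShift q - q.2) ⁻¹' A ∩ coupleRegion} =
        (if x ∈ A then Set.Ico 0 (-y) else ∅) ∪ (if y ∈ A then Set.Ico (-y) (x - y) else ∅) := by
      ext w
      by_cases hw : w < -y
      · have : coupleShift ((x, y), w) - w = x := by simp [coupleShift, hw]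
        simp only [Set.mem_ofPred_eq, Set.mem_inter_iff, Set.mem_preimage, this, coupleRegion,
          Set.mem_union]
        split_ifs <;> simp <;> grind
      · have : coupleShift ((x, y), w) - w = y := by simp [coupleShift, hw]
        simp only [Set.mem_ofPred_eq, Set.mem_inter_iff, Set.mem_preimage, this, coupleRegion,
          Set.mem_union]
        split_ifs <;> simp <;> grind
    rw [e, measure_union]
    · by_cases hxA : x ∈ A <;> by_cases hyA : y ∈ A <;> simp [hxA, hyA, hx, hy]
    · split_ifs <;> simp [Set.disjoint_left]; grind
    · split_ifs <;> simp
  · have h' : ∀ w, ((x, y), w) ∉ coupleRegion := fun w hw => h ⟨hw.1, hw.2.1⟩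
    by_cases hx : 0 < x
    · have hy : 0 < y := not_le.1 fun hy => h ⟨hx, hy⟩
      simp [h', hy, hy.le]
    · simp [h', not_lt.1 hx, hx]

/-- After integration, positive values carry the factor `∫ y⁻` and nonpositive ones the factor `∫
x⁺`; centering makes the two equal, so the two halves of `μ` are reassembled with a common weight.
-/
theorem coupleMeasure_map_displacement {μ : Measure ℝ} [IsProbabilityMeasure μ]
    (hμ : ∫⁻ x, ENNReal.ofReal (-x) ∂μ = ∫⁻ x, ENNReal.ofReal x ∂μ) :
    (coupleMeasure μ).map (fun q => coupleShift q - q.2) =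
      (∫⁻ x, ENNReal.ofReal x ∂μ) • μ := by
  have hm : Measurable fun q : (ℝ × ℝ) × ℝ => coupleShift q - q.2 :=
    measurable_coupleShift.sub measurable_snd
  ext A hA
  rw [Measure.map_apply hm hA, coupleMeasure_apply μ (hm hA)]
  have h1 : Measurable ((A ∩ Set.Ioi 0).indicator (1 : ℝ → ENNReal)) :=
    measurable_one.indicator (hA.inter measurableSet_Ioi)
  have h2 : Measurable ((A ∩ Set.Iic 0).indicator (1 : ℝ → ENNReal)) :=
    measurable_one.indicator (hA.inter measurableSet_Iic)
  calc ∫⁻ p, volume {w | (p, w) ∈ (fun q => coupleShift q - q.2) ⁻¹' A ∩ coupleRegion} ∂(μ.prod μ)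
      = ∫⁻ p, ((A ∩ Set.Ioi 0).indicator 1 p.1 * ENNReal.ofReal (-p.2) +
        ENNReal.ofReal p.1 * (A ∩ Set.Iic 0).indicator 1 p.2) ∂(μ.prod μ) :=
        lintegral_congr fun p => volume_rotation_displacement p.1 p.2 A
    _ = μ (A ∩ Set.Ioi 0) * (∫⁻ x, ENNReal.ofReal (-x) ∂μ) +
        (∫⁻ x, ENNReal.ofReal x ∂μ) * μ (A ∩ Set.Iic 0) := by
        rw [lintegral_add_left (by fun_prop),
          lintegral_prod_mul (g := fun y => ENNReal.ofReal (-y)) h1.aemeasurable (by fun_prop),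
          lintegral_prod_mul (f := ENNReal.ofReal) (by fun_prop) h2.aemeasurable,
          lintegral_indicator_one (hA.inter measurableSet_Ioi),
          lintegral_indicator_one (hA.inter measurableSet_Iic)]
    _ = ((∫⁻ x, ENNReal.ofReal x ∂μ) • μ) A := by
        rw [hμ, mul_comm, ← mul_add, Measure.smul_apply, smul_eq_mul, ← Set.compl_Ioi,
          ← Set.sdiff_eq, measure_inter_add_sdiff A measurableSet_Ioi]

/-- Integrating `w ^ p` over `[0, x - y)` costs at most `(x - y) ^ (p + 1)`: the length of the fibre
accounts for the extra moment. -/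
theorem memLp_snd_coupleMeasure {μ : Measure ℝ} [IsProbabilityMeasure μ] {p : ℕ} (hp : p ≠ 0)
    (hμ : MemLp id ((p + 1 : ℕ) : ENNReal) μ) :
    MemLp (Prod.snd : (ℝ × ℝ) × ℝ → ℝ) p (coupleMeasure μ) := by
  refine ⟨measurable_snd.aestronglyMeasurable, ?_⟩
  have hp' : (p : ENNReal) ≠ 0 := by exact_mod_cast hp
  rw [eLpNorm_lt_top_iff_lintegral_rpow_enorm_lt_top hp' (ENNReal.natCast_ne_top p)]
  have hsub : MemLp (fun q : ℝ × ℝ => q.1 - q.2) ((p + 1 : ℕ) : ENNReal) (μ.prod μ) :=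
    (hμ.comp_fst μ).sub (hμ.comp_snd μ)
  have hfin := lintegral_rpow_enorm_lt_top_of_eLpNorm_lt_top (by simp)
    (ENNReal.natCast_ne_top _) hsub.2
  refine lt_of_le_of_lt ?_ hfin
  simp only [ENNReal.toReal_natCast, ENNReal.rpow_natCast]
  rw [coupleMeasure, ← lintegral_indicator measurableSet_coupleRegion,
    lintegral_prod _ (Measurable.aemeasurable
      ((measurable_snd.enorm.pow_const p).indicator measurableSet_coupleRegion))]
  refine lintegral_mono fun q => ?_
  have hle : ∀ w, coupleRegion.indicator (fun a : (ℝ × ℝ) × ℝ => ‖a.2‖ₑ ^ p) (q, w) ≤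
      (Set.Ico 0 (q.1 - q.2)).indicator (fun _ => ‖q.1 - q.2‖ₑ ^ p) w := by
    intro w
    by_cases hw : (q, w) ∈ coupleRegion
    · have h1 : 0 ≤ w := hw.2.2.1
      have h2 : w < q.1 - q.2 := hw.2.2.2
      rw [Set.indicator_of_mem hw, Set.indicator_of_mem (Set.mem_Ico.2 ⟨h1, h2⟩)]
      refine pow_le_pow_left' (enorm_le_iff_norm_le.2 ?_) p
      rw [Real.norm_of_nonneg h1, Real.norm_of_nonneg (h1.trans h2.le)]
      exact h2.le
    · rw [Set.indicator_of_notMem hw]; exact zero_le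
  refine (lintegral_mono hle).trans ?_
  rw [lintegral_indicator measurableSet_Ico, setLIntegral_const, Real.volume_Ico, sub_zero,
    pow_succ]
  gcongr
  rw [← ofReal_norm, Real.norm_eq_abs]
  exact ENNReal.ofReal_le_ofReal (le_abs_self _)

theorem memLp_top_snd_coupleMeasure {μ : Measure ℝ} [IsProbabilityMeasure μ]
    (hμ : MemLp id ⊤ μ) : MemLp (Prod.snd : (ℝ × ℝ) × ℝ → ℝ) ⊤ (coupleMeasure μ) := by
  have hsub : MemLp (fun q : ℝ × ℝ => q.1 - q.2) ⊤ (μ.prod μ) :=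
    (hμ.comp_fst μ).sub (hμ.comp_snd μ)
  have hae : ∀ᵐ q ∂(coupleMeasure μ),
      ‖q.1.1 - q.1.2‖ₑ ≤ eLpNormEssSup (fun q : ℝ × ℝ => q.1 - q.2) (μ.prod μ) :=
    ae_restrict_of_ae (Measure.quasiMeasurePreserving_fst.ae ae_le_eLpNormEssSup)
  have hfin : eLpNormEssSup (fun q : ℝ × ℝ => q.1 - q.2) (μ.prod μ) ≠ ⊤ := by
    rw [← eLpNorm_exponent_top]; exact hsub.2.ne
  refine memLp_top_of_bound_enorm measurable_snd.aestronglyMeasurable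
    (eLpNormEssSup (fun q : ℝ × ℝ => q.1 - q.2) (μ.prod μ)).toNNReal ?_
  filter_upwards [hae, ae_restrict_mem measurableSet_coupleRegion] with q hq hR
  rw [ENNReal.coe_toNNReal hfin]
  refine le_trans (enorm_le_iff_norm_le.2 ?_) hq
  rw [Real.norm_of_nonneg hR.2.2.1, Real.norm_of_nonneg (hR.2.2.1.trans hR.2.2.2.le)]
  exact hR.2.2.2.le

/-- Every centered law is the law of the difference of two identically distributed random
variables with one moment less. -/
theorem exists_coupling_of_integral_eq_zero (μ : Measure ℝ) [IsProbabilityMeasure μ]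
    (hint : Integrable id μ) (hmean : ∫ x, x ∂μ = 0) :
    ∃ ν : Measure (ℝ × ℝ), IsProbabilityMeasure ν ∧ ν.map Prod.fst = ν.map Prod.snd ∧
      ν.map (fun q => q.2 - q.1) = μ ∧
      (∀ p : ℕ, MemLp id ((p + 1 : ℕ) : ENNReal) μ → MemLp Prod.fst p ν) ∧
      (MemLp id ⊤ μ → MemLp Prod.fst ⊤ ν) := by
  have hsub := integral_eq_lintegral_pos_part_sub_lintegral_neg_part hint
  simp only [id] at hsub
  have hfin : ∫⁻ x, ENNReal.ofReal x ∂μ ≠ ⊤ := hint.lintegral_lt_top.ne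
  have hfin' : ∫⁻ x, ENNReal.ofReal (-x) ∂μ ≠ ⊤ := hint.neg.lintegral_lt_top.ne
  have hbal : ∫⁻ x, ENNReal.ofReal (-x) ∂μ = ∫⁻ x, ENNReal.ofReal x ∂μ := by
    rw [← ENNReal.toReal_eq_toReal_iff' hfin' hfin]
    linarith
  -- The total mass of `coupleMeasure μ` is this integral. When it vanishes there is nothing to
  -- normalize, but then `μ` is the point mass at `0`.
  rcases eq_or_ne (∫⁻ x, ENNReal.ofReal x ∂μ) 0 with h0 | h0
  · have h1 := (lintegral_eq_zero_iff (by fun_prop)).1 h0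
    have h2 := (lintegral_eq_zero_iff (by fun_prop)).1 (hbal.trans h0)
    have hae : (fun x : ℝ => x) =ᵐ[μ] fun _ => 0 := by
      filter_upwards [h1, h2] with x hx1 hx2
      simp at hx1 hx2
      linarith
    have hμ : μ = Measure.dirac 0 := by
      have h := Measure.map_congr (mβ := inferInstance) hae
      simpa [Measure.map_id'] using h
    refine ⟨Measure.dirac (0, 0), inferInstance, ?_, ?_, fun p _ => ?_, fun _ => ?_⟩
    · rw [Measure.map_dirac' measurable_fst, Measure.map_dirac' measurable_snd]
    · rw [Measure.map_dirac' (by fun_prop), hμ]; simp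
    all_goals
      refine (memLp_congr_ae ?_).1 (memLp_const (0 : ℝ))
      rw [Filter.EventuallyEq, ae_dirac_iff (measurableSet_eq_fun (by fun_prop) (by fun_prop))]
  · set m := ∫⁻ x, ENNReal.ofReal x ∂μ
    have hinv : m⁻¹ ≠ ⊤ := ENNReal.inv_ne_top.2 h0
    have hpair : Measurable fun q : (ℝ × ℝ) × ℝ => (q.2, coupleShift q) :=
      measurable_snd.prodMk measurable_coupleShift
    have hdiff : (m⁻¹ • coupleMeasure μ).map (fun q => coupleShift q - q.2) = μ := by
      rw [Measure.map_smul, coupleMeasure_map_displacement hbal, smul_smul,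
        ENNReal.inv_mul_cancel h0 hfin, one_smul]
    have hprob : IsProbabilityMeasure (m⁻¹ • coupleMeasure μ) := by
      constructor
      have hm : Measurable fun q : (ℝ × ℝ) × ℝ => coupleShift q - q.2 :=
        measurable_coupleShift.sub measurable_snd
      rw [← Set.preimage_univ (f := fun q : (ℝ × ℝ) × ℝ => coupleShift q - q.2),
        ← Measure.map_apply hm MeasurableSet.univ, hdiff, measure_univ]
    refine ⟨(m⁻¹ • coupleMeasure μ).map fun q => (q.2, coupleShift q),
      Measure.isProbabilityMeasure_map hpair.aemeasurable, ?_, ?_, fun p hp => ?_, fun h => ?_⟩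
    · rw [Measure.map_map measurable_fst hpair, Measure.map_map measurable_snd hpair]
      change Measure.map Prod.snd _ = Measure.map coupleShift _
      rw [Measure.map_smul, Measure.map_smul, coupleMeasure_map_shift]
    · rw [Measure.map_map (by fun_prop) hpair]
      exact hdiff
    · rw [memLp_map_measure_iff measurable_fst.aestronglyMeasurable hpair.aemeasurable]
      rcases eq_or_ne p 0 with rfl | hp0
      · rw [Nat.cast_zero, memLp_zero_iff_aestronglyMeasurable]
        exact measurable_snd.aestronglyMeasurable
      · exact (memLp_snd_coupleMeasure hp0 hp).smul_measure hinv
    · rw [memLp_map_measure_iff measurable_fst.aestronglyMeasurable hpair.aemeasurable]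
      exact (memLp_top_snd_coupleMeasure h).smul_measure hinv

end Coupling

/-! ### Payoffs as differences of identically distributed payoffs -/

section Decomposition

variable {S : Type*} [MeasurableSpace S] {P : Measure S} [IsProbabilityMeasure P]
  {c : PayoffClass}

theorem mem_payoffs_of_bound {f : S → ℝ} (hf : Measurable f) (C : ℝ) (hC : ∀ s, |f s| ≤ C) :
    f ∈ payoffs P c := by
  have h : ∀ p, MemLp f p P := fun p =>
    MemLp.of_bound hf.aestronglyMeasurable C (Filter.Eventually.of_forall hC)
  cases c with
  | bounded => exact ⟨hf, h ⊤⟩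
  | allMoments => exact ⟨hf, fun p => h p⟩

omit [IsProbabilityMeasure P] in
theorem measurable_payoff (f : payoffs P c) : Measurable (f : S → ℝ) := by
  cases c with
  | bounded => exact f.2.1
  | allMoments => exact f.2.1

theorem integrable_payoff (f : payoffs P c) : Integrable (f : S → ℝ) P := by
  cases c with
  | bounded => exact f.2.2.integrable le_top
  | allMoments => exact memLp_one_iff_integrable.1 (by simpa using f.2.2 1)

omit [IsProbabilityMeasure P] in
theorem mem_payoffs_of_map_eq {S' : Type*} [MeasurableSpace S'] {P' : Measure S'} {f : S → ℝ}
    {f' : S' → ℝ} (hf : Measurable f) (hf' : f' ∈ payoffs P' c) (h : P.map f = P'.map f') :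
    f ∈ payoffs P c := by
  have key : ∀ {p}, Measurable f' → MemLp f' p P' → MemLp f p P := by
    intro p hm hp
    have h1 := memLp_map_measure_iff (p := p) (μ := P) (g := id)
      measurable_id.aestronglyMeasurable hf.aemeasurable
    have h2 := memLp_map_measure_iff (p := p) (μ := P') (g := id)
      measurable_id.aestronglyMeasurable hm.aemeasurable
    rw [h] at h1
    exact h1.1 (h2.2 hp)
  cases c with
  | bounded => exact ⟨hf, key hf'.1 hf'.2⟩
  | allMoments => exact ⟨hf, fun p => key hf'.1 (hf'.2 p)⟩

/-- The coupling for the centered law is realized on `S`, with the mean as `γ`. Its loss of one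
moment is harmless because both payoff classes survive it. -/
theorem IsNonatomic.exists_eqDistrib_sub (hP : IsNonatomic P) (h : payoffs P c) :
    ∃ (w w' : payoffs P c) (γ : ℝ), EqDistrib w w' ∧ EqDistrib h (w' - w + sure P c γ) := by
  set γ := ∫ s, h.1 s ∂P
  set h₀ : payoffs P c := h - sure P c γ with hh₀
  have hm₀ : Measurable h₀.1 := measurable_payoff h₀
  have : IsProbabilityMeasure (P.map h₀.1) := Measure.isProbabilityMeasure_map hm₀.aemeasurable
  have hint : Integrable id (P.map h₀.1) :=
    (integrable_map_measure measurable_id.aestronglyMeasurable hm₀.aemeasurable).2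
      (integrable_payoff h₀)
  have hmean : ∫ x, x ∂(P.map h₀.1) = 0 := by
    rw [integral_map (f := fun x => x) hm₀.aemeasurable measurable_id.aestronglyMeasurable]
    change ∫ s, (h.1 s - γ) ∂P = 0
    rw [integral_sub (integrable_payoff h) (integrable_const γ)]
    simp [γ]
  obtain ⟨ν, hν, hν1, hν2, hνp, hνtop⟩ := exists_coupling_of_integral_eq_zero _ hint hmean
  have hmem : Prod.fst ∈ payoffs ν c := by
    have hlaw : ∀ p, MemLp h₀.1 p P → MemLp id p (P.map h₀.1) := fun p hp =>
      (memLp_map_measure_iff measurable_id.aestronglyMeasurable hm₀.aemeasurable).2 hp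
    cases c with
    | bounded => exact ⟨measurable_fst, hνtop (hlaw _ h₀.2.2)⟩
    | allMoments => exact ⟨measurable_fst, fun p => hνp p (hlaw _ (h₀.2.2 (p + 1)))⟩
  obtain ⟨X, hX, hXν⟩ := hP.exists_map_eq ν
  have e1 : P.map (fun s => (X s).1) = ν.map Prod.fst := by
    rw [← hXν, Measure.map_map measurable_fst hX]; rfl
  have e2 : P.map (fun s => (X s).2) = ν.map Prod.fst := by
    rw [hν1, ← hXν, Measure.map_map measurable_snd hX]; rfl
  have e3 : P.map (fun s => (X s).2 - (X s).1) = P.map h₀.1 := by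
    rw [← hν2, ← hXν, Measure.map_map (by fun_prop) hX]; rfl
  refine ⟨⟨_, mem_payoffs_of_map_eq hX.fst hmem e1⟩, ⟨_, mem_payoffs_of_map_eq hX.snd hmem e2⟩,
    γ, e1.trans e2.symm, ?_⟩
  have hadd : Measurable fun x : ℝ => x + γ := by fun_prop
  have e4 := congrArg (Measure.map fun x : ℝ => x + γ) e3
  rw [Measure.map_map (f := fun s => (X s).2 - (X s).1) hadd (hX.snd.sub hX.fst),
    Measure.map_map hadd hm₀] at e4
  refine Eq.trans ?_ e4.symm
  refine congrArg (Measure.map · P) (funext fun s => ?_)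
  simp [hh₀, sure]

/-- A cyclic sequence with given increments of zero sum. -/
theorem exists_cyclic_primitive (n : ℕ) (x : Fin (n + 1) → ℝ) (hx : ∑ i, x i = 0) :
    ∃ y : Fin (n + 1) → ℝ, ∀ i, y (finRotate (n + 1) i) - y i = x i := by
  -- Partial sums of the increments; the value `0` past the end is never summed. The last index
  -- wraps to the empty sum, which is where the zero total enters.
  let z : ℕ → ℝ := fun i => if h : i < n + 1 then x ⟨i, h⟩ else 0
  have hz : ∀ i : Fin (n + 1), z i = x i := fun i => dif_pos i.isLt
  refine ⟨fun i => ∑ j ∈ Finset.range i, z j, fun i => ?_⟩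
  rcases (Fin.le_last i).eq_or_lt with rfl | hi
  · have : ∑ j ∈ Finset.range (n + 1), z j = 0 := by
      rw [Finset.sum_range, ← hx]; exact Finset.sum_congr rfl fun i _ => hz i
    rw [Finset.sum_range_succ] at this
    have hl := hz (Fin.last n)
    simp only [Fin.val_last] at hl
    simp only [finRotate_last, Fin.val_zero, Finset.range_zero, Finset.sum_empty, Fin.val_last]
    linarith
  · have hi' : (i : ℕ) < n := hi
    have hv : ((finRotate (n + 1) i : Fin (n + 1)) : ℕ) = i + 1 := coe_finRotate_of_ne_last hi.ne
    simp only [hv]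
    rw [Finset.sum_range_succ, hz]
    ring

/-- Reduces the space to a finite set of cells: measurable functions are constant on cells, and
equal masses make every permutation of the cells law preserving. -/
theorem IsUniformOnFinitePartition.exists_index (hP : IsUniformOnFinitePartition P) :
    ∃ (n : ℕ) (idx : S → Fin (n + 1)), Measurable idx ∧ Function.Surjective idx ∧
      (∀ f : S → ℝ, Measurable f → ∀ s t, idx s = idx t → f s = f t) ∧
      ∀ σ : Equiv.Perm (Fin (n + 1)), P.map (σ ∘ idx) = P.map idx := by
  obtain ⟨n, E, hdisj, hcov, hgen, hmass⟩ := hP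
  obtain ⟨s₀⟩ := nonempty_of_isProbabilityMeasure P
  have hex : ∀ s, ∃ i, s ∈ E i := fun s => Set.mem_iUnion.1 (hcov ▸ Set.mem_univ s)
  obtain ⟨n, rfl⟩ : ∃ k, n = k + 1 := by
    obtain ⟨i, -⟩ := hex s₀
    exact Nat.exists_eq_succ_of_ne_zero (Nat.pos_iff_ne_zero.1 i.pos)
  choose idx hidx using hex
  have hE : ∀ i s, s ∈ E i ↔ idx s = i := fun i s =>
    ⟨fun h => by_contra fun hne => Set.disjoint_left.1 (hdisj hne) (hidx s) h, fun h => h ▸ hidx s⟩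
  have hEm : ∀ i, MeasurableSet (E i) := fun i => by
    have : ∀ A ∈ Set.range E, MeasurableSet A := by
      rw [hgen]; exact fun A hA => MeasurableSpace.measurableSet_generateFrom hA
    exact this _ ⟨i, rfl⟩
  have hpre : ∀ i, idx ⁻¹' {i} = E i := fun i => Set.ext fun s => (hE i s).symm
  have hm : Measurable idx := measurable_to_countable' fun i => by rw [hpre]; exact hEm i
  refine ⟨n, idx, hm, fun i => ?_, fun f hf s t hst => ?_, fun σ => ?_⟩
  · have : P (E i) ≠ 0 := by rw [hmass]; exact ENNReal.inv_ne_zero.2 (ENNReal.natCast_ne_top _)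
    obtain ⟨s, hs⟩ := nonempty_of_measure_ne_zero this
    exact ⟨s, (hE i s).1 hs⟩
  · have hsat : ∀ A : Set S, MeasurableSet A → ∀ s t, idx s = idx t → s ∈ A → t ∈ A := by
      intro A hA
      rw [hgen] at hA
      induction A, hA using MeasurableSpace.generateFrom_induction with
      | hC A hA _ =>
        obtain ⟨i, rfl⟩ := hA
        exact fun s t hst hs => (hE i t).2 (hst ▸ (hE i s).1 hs)
      | empty => exact fun s t _ hs => hs
      | compl A _ ih => exact fun s t hst hs ht => hs (ih t s hst.symm ht)
      | iUnion A _ ih =>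
        intro s t hst hs
        obtain ⟨k, hk⟩ := Set.mem_iUnion.1 hs
        exact Set.mem_iUnion.2 ⟨k, ih k s t hst hk⟩
    exact (hsat _ (hf (measurableSet_singleton (f s))) s t hst rfl).symm
  · have hσ : Measurable (σ ∘ idx) := (measurable_of_finite σ).comp hm
    refine Measure.ext_of_singleton fun i => ?_
    rw [Measure.map_apply hσ (measurableSet_singleton i),
      Measure.map_apply hm (measurableSet_singleton i), hpre, hmass]
    have : σ ∘ idx ⁻¹' {i} = E (σ.symm i) := by
      rw [← hpre]; ext s; simp [Equiv.eq_symm_apply]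
    rw [this, hmass]

/-- The cell values minus their average sum to zero, hence are the increments of some `y` around the
cycle of cells; rotating the cells leaves the law of `y` unchanged. -/
theorem IsUniformOnFinitePartition.exists_eqDistrib_sub (hP : IsUniformOnFinitePartition P)
    (h : payoffs P c) :
    ∃ (w w' : payoffs P c) (γ : ℝ), EqDistrib w w' ∧ EqDistrib h (w' - w + sure P c γ) := by
  obtain ⟨n, idx, hm, hsurj, hconst, hperm⟩ := hP.exists_index
  choose sec hsec using hsurj
  set γ : ℝ := (∑ i, h.1 (sec i)) / (n + 1)
  have hsum : ∑ i, (h.1 (sec i) - γ) = 0 := by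
    rw [Finset.sum_sub_distrib, Finset.sum_const, Finset.card_univ, Fintype.card_fin, nsmul_eq_mul]
    push_cast
    rw [mul_div_cancel₀ _ (by positivity), sub_self]
  obtain ⟨y, hy⟩ := exists_cyclic_primitive n _ hsum
  have hmem : ∀ z : Fin (n + 1) → ℝ, z ∘ idx ∈ payoffs P c := fun z =>
    mem_payoffs_of_bound ((measurable_of_finite z).comp hm) (∑ i, |z i|) fun s =>
      Finset.single_le_sum (f := fun i => |z i|) (fun i _ => abs_nonneg _) (Finset.mem_univ _)
  have hrot : Measurable (finRotate (n + 1) ∘ idx) := (measurable_of_finite _).comp hm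
  refine ⟨⟨_, hmem y⟩, ⟨_, hmem (y ∘ finRotate (n + 1))⟩, γ, ?_, ?_⟩
  · have e := congrArg (Measure.map y) (hperm (finRotate (n + 1)))
    rw [Measure.map_map (measurable_of_finite y) hrot,
      Measure.map_map (measurable_of_finite y) hm] at e
    exact e.symm
  · refine congrArg (Measure.map · P) (funext fun s => ?_)
    have h1 := hy (idx s)
    have h2 : h.1 (sec (idx s)) = h.1 s := hconst _ (measurable_payoff h) _ _ (hsec _)
    change h.1 s = y (finRotate (n + 1) (idx s)) - y (idx s) + γ
    linarith

/-- On an adequate space, every random payoff is distributed as a constant plus the difference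
of two identically distributed random payoffs. -/
theorem IsAdequate.exists_eqDistrib_sub (hP : IsAdequate P) (h : payoffs P c) :
    ∃ (w w' : payoffs P c) (γ : ℝ), EqDistrib w w' ∧ EqDistrib h (w' - w + sure P c γ) :=
  hP.elim (fun hP => hP.exists_eqDistrib_sub h) fun hP => hP.exists_eqDistrib_sub h

end Decomposition

/-! ### Certainty equivalents from willingness to pay -/

section CertaintyEquivalent

variable {S : Type*} [MeasurableSpace S] {P : Measure S} [IsProbabilityMeasure P]
  {c : PayoffClass} {R : payoffs P c → payoffs P c → Prop}

theorem sure_sub_sure (a b : ℝ) : sure P c a - sure P c b = sure P c (a - b) := rfl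

theorem sure_add_sure (a b : ℝ) : sure P c a + sure P c b = sure P c (a + b) := rfl

theorem IsMonotoneSecular.sure_iff (hR : IsMonotoneSecular R) (a b : ℝ) :
    R (sure P c a) (sure P c b) ↔ b ≤ a := by
  have hlt : ∀ {a b : ℝ}, b < a → Strict R (sure P c a) (sure P c b) := fun {a b} hab => by
    simpa [sure_add_sure] using hR.monotone (sure P c b) (a - b) (sub_pos.2 hab)
  refine ⟨fun h => not_lt.1 fun hab => (hlt hab).2 h, fun h => ?_⟩
  rcases h.eq_or_lt with rfl | h
  · exact (hR.law_invariant _ _ rfl).1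
  · exact (hlt h).1

/-- `a - ρ(f', a)` is the certainty equivalent of `f'`, hence by law invariance of `f`. Allowing
`f'` to differ from `f` is what lets the decomposition replace a given payoff. -/
theorem IsMonotoneSecular.sure_iff_rho (hR : IsMonotoneSecular R) {f f' : payoffs P c}
    (hf : EqDistrib f f') (a γ : ℝ) :
    R (sure P c γ) f ↔ a - hR.rho f' (sure P c a) ≤ γ := by
  have h1 := hR.law_invariant f f' hf
  have h2 := hR.rho_spec f' (sure P c a)
  rw [sure_sub_sure] at h2
  rw [← hR.sure_iff]
  exact ⟨fun h => hR.trans _ _ _ (hR.trans _ _ _ h h1.1) h2.1,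
    fun h => hR.trans _ _ _ (hR.trans _ _ _ h h2.2) h1.2⟩

end CertaintyEquivalent

end InsurancePropensity

/-! ### The equivalence -/

open InsurancePropensity

theorem mainTheorem3 {S : Type*} [MeasurableSpace S] (P : MeasureTheory.Measure S)
    [MeasureTheory.IsProbabilityMeasure P] (hP : InsurancePropensity.IsAdequate P)
    (c : InsurancePropensity.PayoffClass)
    (RA RB : InsurancePropensity.payoffs P c → InsurancePropensity.payoffs P c → Prop)
    (hA : InsurancePropensity.IsMonotoneSecular RA)
    (hB : InsurancePropensity.IsMonotoneSecular RB) :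
    InsurancePropensity.WeaklyMoreRiskAverse RB RA ↔
      InsurancePropensity.MorePropenseToFullInsurance hB hA := by
  constructor
  · rintro h w f g - ⟨π, rfl⟩
    have e : w + (-w - sure P c π) = sure P c (-π) := by ext s; simp [sure]; ring
    rw [e]
    -- The sure payoff tested is A's own certainty equivalent of `w + g`; by (i), B's is no larger.
    have hA' := (hA.sure_iff_rho (f := w + g) rfl (-π) _).2 le_rfl
    have hB' := (hB.sure_iff_rho (f := w + g) rfl (-π) _).1 (h _ _ hA')
    linarith
  · intro h f γ hγ
    obtain ⟨w, w', a, hw, hf⟩ := hP.exists_eqDistrib_sub f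
    -- The risk to insure is `w'`: the full insurance `-w' + a` yields the sure `a`, while its
    -- equally distributed rival `-w + a` yields `w' - w + a`, a copy in law of `f`.
    have hg : EqDistrib (-w - sure P c (-a)) (-w' - sure P c (-a)) := by
      have hm : Measurable fun x : ℝ => -x - -a := by fun_prop
      have e := congrArg (MeasureTheory.Measure.map fun x : ℝ => -x - -a) hw
      rwa [MeasureTheory.Measure.map_map hm (measurable_payoff w),
        MeasureTheory.Measure.map_map hm (measurable_payoff w')] at e
    have key := h w' _ _ hg ⟨-a, rfl⟩
    have e1 : w' + (-w - sure P c (-a)) = w' - w + sure P c a := by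
      ext s; simp [sure]; ring
    have e2 : w' + (-w' - sure P c (-a)) = sure P c a := by ext s; simp [sure]
    rw [e1, e2] at key
    rw [hA.sure_iff_rho hf a] at hγ
    rw [hB.sure_iff_rho hf a]
    linarith
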